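/- Let $(M,g)$ be a connected surface, with or without boundary, equipped with a smooth Riemannian metric $g$; let $K$ be its Gaussian curvature and $\Delta_g=\mathrm{div}\,\mathrm{grad}$ its Laplace–Beltrami operator. Let $\phi\colon M\to\mathbb R$ be a harmonic function (that is, $\phi$ is $C^2$ on $M$ and $\Delta_g\phi=0$), let $X=\mathrm{grad}\,\phi$ be the corresponding potential vector field (so $g(X,\cdot)=d\phi$), and put $|X|=g(X,X)^{1/2}$ and $\mathrm{Sing}(X)=\{x\in M: X(x)=0\}$. Let $\rho_0>0$ be a constant density. (1) At every point of $M\setminus\mathrm{Sing}(X)$ near which $\phi$ is of class $C^3$ (so that $|X|$ is $C^2$ there), $$-\Delta_g\log|X|=-K .$$ (2) $X$ is a steady solution of the Euler equations: there is a $C^1$ function $p$ on $M$ (a pressure) with $$\nabla_XX=-\frac1{\rho_0}\,\mathrm{grad}\,p,\qquad \mathrm{div}\,X=0 .$$ (3) For every such pressure $p$ there is a constant $p_0$ with $p-p_0=-\frac{\rho_0}{2}|X|^2$ on $M$, and at every point of $M\setminus\mathrm{Sing}(X)$ near which $\phi$ is of class $C^3$, $$-\Delta_g\log(p_0-p)=-2K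 .$$ -/

import Mathlib

open Set Manifold Bundle
open scoped ContDiff

noncomputable section

/-- The coordinate plane in which local coordinates `(x⁰, x¹)` of a surface take their values. -/
abbrev Plane : Type := EuclideanSpace ℝ (Fin 2)

/-! ### Formulas in local coordinates

`s` is the set on which derivatives are taken (the range of the model, that is the plane for a
surface without boundary and a half-plane for a surface with boundary), and `γ` is the matrix
`(g_ij)` of the metric as a function of the coordinates. -/

namespace Coord

/-- The partial derivative `∂_i f` (one-sided at boundary points of `s`). -/
def pd (s : Set Plane) (i : Fin 2) (f : Plane → ℝ) (y : Plane) : ℝ :=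
  fderivWithin ℝ f s y (EuclideanSpace.single i 1)

/-- The area density `√(det g_ij)`. -/
def density (γ : Plane → Matrix (Fin 2) (Fin 2) ℝ) (y : Plane) : ℝ :=
  Real.sqrt (γ y).det

/-- The components `(grad f)^i = g^{ij} ∂_j f` of the gradient. -/
def grad (s : Set Plane) (γ : Plane → Matrix (Fin 2) (Fin 2) ℝ) (f : Plane → ℝ)
    (i : Fin 2) (y : Plane) : ℝ :=
  ∑ j, (γ y)⁻¹ i j * pd s j f y

/-- The divergence `(det g)^{-1/2} ∂_i ((det g)^{1/2} V^i)` of a vector field with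
components `V`. -/
def div (s : Set Plane) (γ : Plane → Matrix (Fin 2) (Fin 2) ℝ) (V : Fin 2 → Plane → ℝ)
    (y : Plane) : ℝ :=
  (density γ y)⁻¹ * ∑ i, pd s i (fun z => density γ z * V i z) y

/-- The Laplace–Beltrami operator `div grad f`. -/
def laplacian (s : Set Plane) (γ : Plane → Matrix (Fin 2) (Fin 2) ℝ) (f : Plane → ℝ)
    (y : Plane) : ℝ :=
  div s γ (grad s γ f) y

/-- The Christoffel symbol `Γ^k_{ij}` of the Levi-Civita connection. -/
def christoffel (s : Set Plane) (γ : Plane → Matrix (Fin 2) (Fin 2) ℝ) (k i j : Fin 2)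
    (y : Plane) : ℝ :=
  (1 / 2) * ∑ l, (γ y)⁻¹ k l *
    (pd s i (fun z => γ z j l) y + pd s j (fun z => γ z i l) y - pd s l (fun z => γ z i j) y)

/-- The components of `∇_V W` for vector fields with components `V` and `W`. -/
def nabla (s : Set Plane) (γ : Plane → Matrix (Fin 2) (Fin 2) ℝ) (V W : Fin 2 → Plane → ℝ)
    (k : Fin 2) (y : Plane) : ℝ :=
  (∑ i, V i y * pd s i (W k) y) + ∑ i, ∑ j, christoffel s γ k i j y * V i y * W j y

/-- The component of `R(∂_i, ∂_j) ∂_k = ∇_i ∇_j ∂_k - ∇_j ∇_i ∂_k` along `∂_l`. -/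
def riemann (s : Set Plane) (γ : Plane → Matrix (Fin 2) (Fin 2) ℝ) (l i j k : Fin 2)
    (y : Plane) : ℝ :=
  pd s i (christoffel s γ l j k) y - pd s j (christoffel s γ l i k) y
    + ∑ m, (christoffel s γ l i m y * christoffel s γ m j k y
      - christoffel s γ l j m y * christoffel s γ m i k y)

/-- The Gaussian curvature `g(R(∂_0, ∂_1) ∂_1, ∂_0) / det g` (positive on round spheres). -/
def gaussCurvature (s : Set Plane) (γ : Plane → Matrix (Fin 2) (Fin 2) ℝ) (y : Plane) : ℝ :=
  (∑ l, γ y l 0 * riemann s γ l 0 1 1 y) / (γ y).det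

end Coord

/-! ### Surfaces -/

namespace Surface

variable {H : Type*} [TopologicalSpace H] {I : ModelWithCorners ℝ Plane H}
  {M : Type*} [TopologicalSpace M] [ChartedSpace H M] [IsManifold I ∞ M]

/-- The coordinate vector field `∂_i` of the chart `e`, at the point with coordinates `y`. -/
def coordVec (I : ModelWithCorners ℝ Plane H) (e : OpenPartialHomeomorph M H) (i : Fin 2)
    (y : Plane) : TangentSpace I ((e.extend I).symm y) :=
  mfderivWithin 𝓘(ℝ, Plane) I (e.extend I).symm (range I) y
    (EuclideanSpace.single i (1 : ℝ) : Plane)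

/-- The matrix `g_ij = g(∂_i, ∂_j)` of the metric in the chart `e`. -/
def metricMatrix (g : ContMDiffRiemannianMetric I ∞ Plane (TangentSpace I : M → Type _))
    (e : OpenPartialHomeomorph M H) (y : Plane) : Matrix (Fin 2) (Fin 2) ℝ :=
  Matrix.of fun i j =>
    g.inner ((e.extend I).symm y) (coordVec I e i y) (coordVec I e j y)

/-- The components of the vector field `X` in the chart `e`. -/
def components (X : (x : M) → TangentSpace I x) (e : OpenPartialHomeomorph M H) (i : Fin 2)
    (y : Plane) : ℝ :=
  (show Plane from
    mfderiv I 𝓘(ℝ, Plane) (e.extend I) ((e.extend I).symm y) (X ((e.extend I).symm y))) i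

/-- `Δ_g f` at `x`, computed in the chart `e` (whose domain should contain `x`). -/
def laplacianIn (g : ContMDiffRiemannianMetric I ∞ Plane (TangentSpace I : M → Type _))
    (e : OpenPartialHomeomorph M H) (f : M → ℝ) (x : M) : ℝ :=
  Coord.laplacian (range I) (metricMatrix g e) (f ∘ (e.extend I).symm) (e.extend I x)

/-- The Gaussian curvature at `x`, computed in the chart `e` (whose domain should
contain `x`). -/
def gaussCurvatureIn (g : ContMDiffRiemannianMetric I ∞ Plane (TangentSpace I : M → Type _))
    (e : OpenPartialHomeomorph M H) (x : M) : ℝ :=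
  Coord.gaussCurvature (range I) (metricMatrix g e) (e.extend I x)

/-- The speed `|X| = g(X, X)^{1/2}`. -/
def speed (g : ContMDiffRiemannianMetric I ∞ Plane (TangentSpace I : M → Type _))
    (X : (x : M) → TangentSpace I x) (x : M) : ℝ :=
  Real.sqrt (g.inner x (X x) (X x))

/-- `φ` is a velocity potential of `X`: `X^♭ = dφ`, that is `X = grad φ`. -/
def IsVelocityPotential
    (g : ContMDiffRiemannianMetric I ∞ Plane (TangentSpace I : M → Type _))
    (X : (x : M) → TangentSpace I x) (φ : M → ℝ) : Prop :=
  MDifferentiable I 𝓘(ℝ, ℝ) φ ∧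
    ∀ (x : M) (v : TangentSpace I x), g.inner x (X x) v = mfderiv I 𝓘(ℝ, ℝ) φ x v

/-- `φ` is a harmonic function: it is `C²` and `Δ_g φ = 0` in local coordinates. -/
def IsHarmonic (g : ContMDiffRiemannianMetric I ∞ Plane (TangentSpace I : M → Type _))
    (φ : M → ℝ) : Prop :=
  ContMDiff I 𝓘(ℝ, ℝ) 2 φ ∧
    ∀ e ∈ IsManifold.maximalAtlas I ∞ M, ∀ x ∈ e.source, laplacianIn g e φ x = 0

/-- `(X, p)` solves the steady Euler equations with constant density `ρ₀`:
`∇_X X = -(1/ρ₀) grad p` and `div X = 0`, in local coordinates. -/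
def IsSteadyEulerSolution
    (g : ContMDiffRiemannianMetric I ∞ Plane (TangentSpace I : M → Type _))
    (ρ₀ : ℝ) (X : (x : M) → TangentSpace I x) (p : M → ℝ) : Prop :=
  ContMDiff I 𝓘(ℝ, ℝ) 1 p ∧
    ∀ e ∈ IsManifold.maximalAtlas I ∞ M, ∀ x ∈ e.source,
      (∀ k, Coord.nabla (range I) (metricMatrix g e) (components X e) (components X e) k
          (e.extend I x)
        = -(1 / ρ₀) * Coord.grad (range I) (metricMatrix g e) (p ∘ (e.extend I).symm) k
          (e.extend I x)) ∧
      Coord.div (range I) (metricMatrix g e) (components X e) (e.extend I x) = 0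

end Surface

end

/-! Away from its zeros a harmonic gradient conformally flattens the metric. The forms `u = dφ` and
`w = *dφ` are orthogonal and both of length `|X|`, so in dimension two `g = |X|⁻² (u ⊗ u + w ⊗ w)`.
The form `u` is closed because second derivatives commute, and `w` is closed exactly because `Δφ =
0`. Closed forms are locally differentials of functions, so `u ⊗ u + w ⊗ w` is a flat metric, and
the conformal change law `K = Δ_g ℓ` for `g = e^{-2ℓ} · flat` with `ℓ = log |X|` is the curvature
formula.

No isothermal chart is built. The law is checked in an arbitrary chart as an algebraic identity in
`u`, `w`, `ℓ` and their derivatives (`IsMetricOn.gaussCurvature_eq_laplacian`), starting from a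
curvature formula in which only Christoffel symbols of the first kind are differentiated
(`IsMetricOn.gaussCurvature_eq`). The form `u` must be `C²` there, which is where `φ` of class `C³`
is used.

For the Euler equations, symmetry of the Hessian of `φ` gives `∇_X X = grad (|X|²/2)`
(`IsMetricOn.nabla_grad`). Hence `-(ρ₀/2)|X|²` is a pressure, and any other pressure has the same
gradient, so differs by a constant on the connected surface. Then `log (p₀ - p) = log (ρ₀/2) + 2 log
|X|`, and the second curvature formula follows from the first. -/

namespace Coord

variable {T : Set Plane} {y : Plane} {i j : Fin 2} {f f' : Plane → ℝ}
  {γ : Plane → Matrix (Fin 2) (Fin 2) ℝ}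

/-! ### Calculus of partial derivatives -/

theorem pd_congr (h : EqOn f f' T) (hy : y ∈ T) : pd T i f y = pd T i f' y := by
  simp only [pd, fderivWithin_congr h (h hy)]

theorem pd_add (hT : UniqueDiffWithinAt ℝ T y) (hf : DifferentiableWithinAt ℝ f T y)
    (hf' : DifferentiableWithinAt ℝ f' T y) :
    pd T i (fun z => f z + f' z) y = pd T i f y + pd T i f' y := by
  simp only [pd, fderivWithin_fun_add hT hf hf', add_apply]

theorem pd_sub (hT : UniqueDiffWithinAt ℝ T y) (hf : DifferentiableWithinAt ℝ f T y)
    (hf' : DifferentiableWithinAt ℝ f' T y) :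
    pd T i (fun z => f z - f' z) y = pd T i f y - pd T i f' y := by
  simp only [pd, fderivWithin_fun_sub hT hf hf', sub_apply]

theorem pd_neg (hT : UniqueDiffWithinAt ℝ T y) :
    pd T i (fun z => -f z) y = -pd T i f y := by
  simp only [pd, fderivWithin_fun_neg hT, neg_apply]

theorem pd_mul (hT : UniqueDiffWithinAt ℝ T y) (hf : DifferentiableWithinAt ℝ f T y)
    (hf' : DifferentiableWithinAt ℝ f' T y) :
    pd T i (fun z => f z * f' z) y = pd T i f y * f' y + f y * pd T i f' y := by
  simp only [pd, fderivWithin_fun_mul hT hf hf', add_apply, smul_apply, smul_eq_mul]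
  ring

theorem pd_const_mul (hT : UniqueDiffWithinAt ℝ T y) (c : ℝ)
    (hf : DifferentiableWithinAt ℝ f T y) :
    pd T i (fun z => c * f z) y = c * pd T i f y := by
  simp only [pd, fderivWithin_const_mul hT hf, smul_apply, smul_eq_mul]

theorem pd_const_add (c : ℝ) : pd T i (fun z => c + f z) y = pd T i f y := by
  simp only [pd, fderivWithin_const_add]

theorem pd_exp (hT : UniqueDiffWithinAt ℝ T y) (hf : DifferentiableWithinAt ℝ f T y) :
    pd T i (fun z => Real.exp (f z)) y = Real.exp (f y) * pd T i f y := by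
  simp only [pd, hf.hasFDerivWithinAt.exp.fderivWithin hT, smul_apply, smul_eq_mul]

theorem contDiffOn_pd {n m : WithTop ℕ∞} (hT : UniqueDiffOn ℝ T) (hf : ContDiffOn ℝ n f T)
    (h : m + 1 ≤ n) : ContDiffOn ℝ m (pd T i f) T :=
  (hf.fderivWithin hT h).clm_apply contDiffOn_const

/-- At boundary points, symmetry of the second derivative is inherited from interior points by a
limit; this is why `T` must lie in the closure of its interior. -/
theorem pd_comm (hT : UniqueDiffOn ℝ T) (hT' : T ⊆ closure (interior T))
    (hf : ContDiffOn ℝ 2 f T) (hy : y ∈ T) :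
    pd T i (pd T j f) y = pd T j (pd T i f) y := by
  have hd : DifferentiableWithinAt ℝ (fderivWithin ℝ f T) T y :=
    ((hf.fderivWithin hT (m := 1) (by norm_num)).differentiableOn (by norm_num)) y hy
  have key : ∀ a b : Fin 2, pd T a (pd T b f) y =
      fderivWithin ℝ (fderivWithin ℝ f T) T y (EuclideanSpace.single a 1)
        (EuclideanSpace.single b 1) := by
    intro a b
    have : pd T b f = fun z => fderivWithin ℝ f T z (EuclideanSpace.single b 1) := rfl
    rw [this, pd, fderivWithin_clm_apply (hT y hy) hd (differentiableWithinAt_const _)]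
    simp
  rw [key, key]
  exact ((hf y hy).isSymmSndFDerivWithinAt (by simp) hT (hT' hy) hy).eq _ _

/-! ### Restriction to a relatively open subset -/

theorem pd_inter {s O : Set Plane} (hO : IsOpen O) (hy : y ∈ O) :
    pd (s ∩ O) i f y = pd s i f y := by
  simp only [pd, fderivWithin_inter (hO.mem_nhds hy)]

/-- The set and the function change together: in nested operators the inner expressions agree only
on `s ∩ O`, and this suffices for the outer derivative. -/
theorem pd_inter_congr {s O : Set Plane} (hO : IsOpen O) (hy : y ∈ s ∩ O)
    (h : EqOn f f' (s ∩ O)) : pd s i f y = pd (s ∩ O) i f' y := by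
  rw [← pd_inter hO hy.2, pd_congr h hy]

theorem grad_inter {s O : Set Plane} (hO : IsOpen O) (hy : y ∈ s ∩ O)
    (h : EqOn f f' (s ∩ O)) : grad s γ f i y = grad (s ∩ O) γ f' i y := by
  simp only [grad, pd_inter_congr hO hy h]

theorem div_inter {s O : Set Plane} {V V' : Fin 2 → Plane → ℝ} (hO : IsOpen O)
    (hy : y ∈ s ∩ O) (h : ∀ i, EqOn (V i) (V' i) (s ∩ O)) :
    div s γ V y = div (s ∩ O) γ V' y := by
  have : ∀ i, pd s i (fun z => density γ z * V i z) y =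
      pd (s ∩ O) i (fun z => density γ z * V' i z) y := fun i =>
    pd_inter_congr hO hy fun z hz => by simp only [h i hz]
  simp only [div, this]

theorem laplacian_inter {s O : Set Plane} (hO : IsOpen O) (hy : y ∈ s ∩ O)
    (h : EqOn f f' (s ∩ O)) : laplacian s γ f y = laplacian (s ∩ O) γ f' y :=
  div_inter hO hy fun _ _ hz => grad_inter hO hz h

theorem christoffel_inter {s O : Set Plane} (hO : IsOpen O) (hy : y ∈ s ∩ O) (k : Fin 2) :
    christoffel s γ k i j y = christoffel (s ∩ O) γ k i j y := by
  simp only [christoffel, pd_inter hO hy.2]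

theorem nabla_inter {s O : Set Plane} {V V' : Fin 2 → Plane → ℝ} (hO : IsOpen O)
    (hy : y ∈ s ∩ O) (h : ∀ i, EqOn (V i) (V' i) (s ∩ O)) (k : Fin 2) :
    nabla s γ V V k y = nabla (s ∩ O) γ V' V' k y := by
  simp only [nabla, pd_inter_congr hO hy (h k), h _ hy, christoffel_inter hO hy]

theorem gaussCurvature_inter {s O : Set Plane} (hO : IsOpen O) (hy : y ∈ s ∩ O) :
    gaussCurvature s γ y = gaussCurvature (s ∩ O) γ y := by
  have : ∀ i l j k, pd s i (christoffel s γ l j k) y =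
      pd (s ∩ O) i (christoffel (s ∩ O) γ l j k) y := fun i l j k =>
    pd_inter_congr hO hy fun z hz => christoffel_inter hO hz l
  simp only [gaussCurvature, riemann, this, christoffel_inter hO hy]

theorem subset_closure_interior_inter {s O : Set Plane} (hO : IsOpen O)
    (hs : s ⊆ closure (interior s)) : s ∩ O ⊆ closure (interior (s ∩ O)) := by
  rw [interior_inter, hO.interior_eq]
  exact fun z hz => hO.closure_inter ⟨hs hz.1, hz.2⟩

/-! ### Riemannian metrics in coordinates -/

/-- `γ` is the matrix of a Riemannian metric of class `C^n` on the coordinate domain `T`. -/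
structure IsMetricOn (n : WithTop ℕ∞) (T : Set Plane)
    (γ : Plane → Matrix (Fin 2) (Fin 2) ℝ) : Prop where
  uniqueDiffOn : UniqueDiffOn ℝ T
  subset_closure : T ⊆ closure (interior T)
  contDiffOn : ∀ i j, ContDiffOn ℝ n (fun z => γ z i j) T
  -- Required off `T` as well, so that the two off-diagonal entries are equal as functions and can
  -- be exchanged under `pd`.
  symm : ∀ z, γ z 0 1 = γ z 1 0
  pos : ∀ z ∈ T, 0 < γ z 0 0
  det_pos : ∀ z ∈ T, 0 < (γ z).det

theorem IsMetricOn.inter {n : WithTop ℕ∞} {s O : Set Plane} (h : IsMetricOn n s γ)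
    (hO : IsOpen O) : IsMetricOn n (s ∩ O) γ where
  uniqueDiffOn := h.uniqueDiffOn.inter hO
  subset_closure := subset_closure_interior_inter hO h.subset_closure
  contDiffOn i j := (h.contDiffOn i j).mono inter_subset_left
  symm := h.symm
  pos z hz := h.pos z hz.1
  det_pos z hz := h.det_pos z hz.1

theorem inv_fin_two (A : Matrix (Fin 2) (Fin 2) ℝ) :
    A⁻¹ 0 0 = A 1 1 / A.det ∧ A⁻¹ 0 1 = -A 0 1 / A.det ∧
      A⁻¹ 1 0 = -A 1 0 / A.det ∧ A⁻¹ 1 1 = A 0 0 / A.det := by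
  simp only [Matrix.inv_def, Matrix.adjugate_fin_two, Ring.inverse_eq_inv', Matrix.smul_apply,
    smul_eq_mul, div_eq_inv_mul]
  simp

theorem IsMetricOn.contDiffOn_det {n : WithTop ℕ∞} (h : IsMetricOn n T γ) :
    ContDiffOn ℝ n (fun z => (γ z).det) T := by
  simp only [Matrix.det_fin_two]
  exact ((h.contDiffOn 0 0).mul (h.contDiffOn 1 1)).sub ((h.contDiffOn 0 1).mul (h.contDiffOn 1 0))

theorem IsMetricOn.contDiffOn_inv {n : WithTop ℕ∞} (h : IsMetricOn n T γ) (i j : Fin 2) :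
    ContDiffOn ℝ n (fun z => (γ z)⁻¹ i j) T := by
  have hd : ∀ z ∈ T, (γ z).det ≠ 0 := fun z hz => (h.det_pos z hz).ne'
  have h00 := (h.contDiffOn 1 1).div h.contDiffOn_det hd
  have h01 := (h.contDiffOn 0 1).neg.div h.contDiffOn_det hd
  have h10 := (h.contDiffOn 1 0).neg.div h.contDiffOn_det hd
  have h11 := (h.contDiffOn 0 0).div h.contDiffOn_det hd
  fin_cases i <;> fin_cases j
  · exact h00.congr fun z _ => (inv_fin_two (γ z)).1
  · exact h01.congr fun z _ => (inv_fin_two (γ z)).2.1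
  · exact h10.congr fun z _ => (inv_fin_two (γ z)).2.2.1
  · exact h11.congr fun z _ => (inv_fin_two (γ z)).2.2.2

theorem IsMetricOn.contDiffOn_density {n : WithTop ℕ∞} (h : IsMetricOn n T γ) :
    ContDiffOn ℝ n (density γ) T :=
  h.contDiffOn_det.sqrt fun z hz => (h.det_pos z hz).ne'

theorem IsMetricOn.contDiffOn_grad {n m k : WithTop ℕ∞} (h : IsMetricOn n T γ)
    (hf : ContDiffOn ℝ k f T) (hm : m + 1 ≤ k) (hmn : m ≤ n) (i : Fin 2) :
    ContDiffOn ℝ m (grad T γ f i) T :=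
  ContDiffOn.sum fun j _ => ((h.contDiffOn_inv i j).of_le hmn).mul
    (contDiffOn_pd h.uniqueDiffOn hf hm)

/-- Lowering the index of a raised covector gives it back. -/
theorem sum_mul_sum_inv {A : Matrix (Fin 2) (Fin 2) ℝ} (hA : A.det ≠ 0) (u : Fin 2 → ℝ)
    (l : Fin 2) : ∑ k, A l k * ∑ j, A⁻¹ k j * u j = u l := by
  have : A.mulVec (A⁻¹.mulVec u) = u := by
    rw [Matrix.mulVec_mulVec, Matrix.mul_nonsing_inv A (isUnit_iff_ne_zero.2 hA),
      Matrix.one_mulVec]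
  exact congrFun this l

theorem sum_inv_mul_sum {A : Matrix (Fin 2) (Fin 2) ℝ} (hA : A.det ≠ 0) (u : Fin 2 → ℝ)
    (l : Fin 2) : ∑ k, A⁻¹ l k * ∑ j, A k j * u j = u l := by
  have : A⁻¹.mulVec (A.mulVec u) = u := by
    rw [Matrix.mulVec_mulVec, Matrix.nonsing_inv_mul A (isUnit_iff_ne_zero.2 hA),
      Matrix.one_mulVec]
  exact congrFun this l

theorem IsMetricOn.sum_mul_grad {n : WithTop ℕ∞} (h : IsMetricOn n T γ) (hy : y ∈ T)
    (l : Fin 2) : ∑ k, γ y l k * grad T γ f k y = pd T l f y :=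
  sum_mul_sum_inv (h.det_pos y hy).ne' (fun j => pd T j f y) l

/-! ### Christoffel symbols and the curvature formula. -/

/-- The Christoffel symbol of the first kind. -/
noncomputable def christoffelFirst (s : Set Plane) (γ : Plane → Matrix (Fin 2) (Fin 2) ℝ)
    (l i j : Fin 2) (y : Plane) : ℝ :=
  (1 / 2) *
    (pd s i (fun z => γ z j l) y + pd s j (fun z => γ z i l) y - pd s l (fun z => γ z i j) y)

theorem christoffel_eq (s : Set Plane) (k : Fin 2) :
    christoffel s γ k i j y = ∑ l, (γ y)⁻¹ k l * christoffelFirst s γ l i j y := by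
  simp only [christoffel, christoffelFirst, Finset.mul_sum]
  exact Finset.sum_congr rfl fun l _ => by ring

theorem IsMetricOn.sum_mul_christoffel {n : WithTop ℕ∞} (h : IsMetricOn n T γ) (hy : y ∈ T)
    (l : Fin 2) : ∑ k, γ y l k * christoffel T γ k i j y = christoffelFirst T γ l i j y := by
  simp only [christoffel_eq]
  exact sum_mul_sum_inv (h.det_pos y hy).ne' (fun l => christoffelFirst T γ l i j y) l

theorem IsMetricOn.contDiffOn_christoffelFirst {n m : WithTop ℕ∞} (h : IsMetricOn n T γ)
    (hm : m + 1 ≤ n) (l i j : Fin 2) : ContDiffOn ℝ m (christoffelFirst T γ l i j) T :=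
  have hpd := fun a b c => contDiffOn_pd (i := a) h.uniqueDiffOn (h.contDiffOn b c) hm
  contDiffOn_const.mul (((hpd i j l).add (hpd j i l)).sub (hpd l i j))

theorem IsMetricOn.contDiffOn_christoffel {n m : WithTop ℕ∞} (h : IsMetricOn n T γ)
    (hm : m + 1 ≤ n) (k i j : Fin 2) : ContDiffOn ℝ m (christoffel T γ k i j) T :=
  (ContDiffOn.sum fun l _ => ((h.contDiffOn_inv k l).of_le (le_self_add.trans hm)).mul
    (h.contDiffOn_christoffelFirst hm l i j)).congr fun _ _ => christoffel_eq T k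

/-- The curvature formula
`K det g = ∂₀ Γ_{0,11} - ∂₁ Γ_{0,01} + g^{lm} (Γ_{l,01} Γ_{m,01} - Γ_{l,00} Γ_{m,11})`. -/
theorem IsMetricOn.gaussCurvature_eq (h : IsMetricOn 2 T γ) (hy : y ∈ T) :
    gaussCurvature T γ y * (γ y).det =
      pd T 0 (christoffelFirst T γ 0 1 1) y - pd T 1 (christoffelFirst T γ 0 0 1) y +
        ∑ l, (christoffelFirst T γ l 0 1 y * christoffel T γ l 0 1 y -
          christoffelFirst T γ l 0 0 y * christoffel T γ l 1 1 y) := by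
  have hu := h.uniqueDiffOn y hy
  have hγ : ∀ a b, DifferentiableWithinAt ℝ (fun z => γ z a b) T y := fun a b =>
    (h.contDiffOn a b).differentiableOn (by norm_num) y hy
  have hΓ : ∀ a b c, DifferentiableWithinAt ℝ (christoffel T γ a b c) T y := fun a b c =>
    (h.contDiffOn_christoffel (m := 1) (by norm_num) a b c).differentiableOn (by norm_num) y hy
  -- The product rule for `Γ_{0,jk} = g_{0m} Γ^m_{jk}`: it trades `g_{0m} ∂_i Γ^m_{jk}` for `∂_i
  -- Γ_{0,jk}`, so the inverse metric is never differentiated.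
  have lower : ∀ i j k, pd T i (christoffelFirst T γ 0 j k) y =
      (pd T i (fun z => γ z 0 0) y * christoffel T γ 0 j k y +
        γ y 0 0 * pd T i (christoffel T γ 0 j k) y) +
      (pd T i (fun z => γ z 0 1) y * christoffel T γ 1 j k y +
        γ y 0 1 * pd T i (christoffel T γ 1 j k) y) := by
    intro i j k
    rw [pd_congr (f' := fun z => γ z 0 0 * christoffel T γ 0 j k z +
        γ z 0 1 * christoffel T γ 1 j k z) _ hy,
      pd_add hu ((hγ _ _).fun_mul (hΓ _ _ _)) ((hγ _ _).fun_mul (hΓ _ _ _)),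
      pd_mul hu (hγ _ _) (hΓ _ _ _), pd_mul hu (hγ _ _) (hΓ _ _ _)]
    intro z hz
    rw [← h.sum_mul_christoffel hz, Fin.sum_univ_two]
  have hsym : (fun z => γ z 1 0) = fun z => γ z 0 1 := funext fun z => (h.symm z).symm
  have e1 := h.sum_mul_christoffel (i := 0) (j := 0) hy 0
  have e2 := h.sum_mul_christoffel (i := 0) (j := 1) hy 0
  have e3 := h.sum_mul_christoffel (i := 1) (j := 1) hy 0
  have e4 := h.sum_mul_christoffel (i := 1) (j := 0) hy 0
  rw [gaussCurvature, div_mul_cancel₀ _ (h.det_pos y hy).ne', lower, lower]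
  simp only [Fin.sum_univ_two, riemann] at *
  -- Compatibility of the connection with the metric, `∂_a g_{bc} = Γ_{b,ac} + Γ_{c,ab}`, in the
  -- four cases that occur.
  have l00 : pd T 0 (fun z => γ z 0 0) y =
      christoffelFirst T γ 0 0 0 y + christoffelFirst T γ 0 0 0 y := by
    simp only [christoffelFirst]; ring
  have l01 : pd T 0 (fun z => γ z 0 1) y =
      christoffelFirst T γ 1 0 0 y + christoffelFirst T γ 0 0 1 y := by
    simp only [christoffelFirst, hsym]; ring
  have l10 : pd T 1 (fun z => γ z 0 0) y =
      christoffelFirst T γ 0 0 1 y + christoffelFirst T γ 0 0 1 y := by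
    simp only [christoffelFirst, hsym]; ring
  have l11 : pd T 1 (fun z => γ z 0 1) y =
      christoffelFirst T γ 1 0 1 y + christoffelFirst T γ 0 1 1 y := by
    simp only [christoffelFirst, hsym]; ring
  have s1 : christoffel T γ 0 1 0 y = christoffel T γ 0 0 1 y := by
    simp only [christoffel, hsym, Fin.sum_univ_two]; ring
  have s2 : christoffel T γ 1 1 0 y = christoffel T γ 1 0 1 y := by
    simp only [christoffel, hsym, Fin.sum_univ_two]; ring
  rw [l00, l01, l10, l11, ← h.symm y, s1, s2]
  rw [s1, s2] at e4
  linear_combination christoffel T γ 0 1 1 y * e1 + christoffel T γ 1 1 1 y * e2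
    - christoffel T γ 0 0 1 y * e2 - christoffel T γ 1 0 1 y * e3

/-! ### Partial derivatives bundled with differentiability. -/

/-- `f` is differentiable at `y` within `T`, with partial derivative `a` in direction `i`. -/
structure HasPd (T : Set Plane) (i : Fin 2) (f : Plane → ℝ) (a : ℝ) (y : Plane) : Prop where
  differentiable : DifferentiableWithinAt ℝ f T y
  unique : UniqueDiffWithinAt ℝ T y
  pd_eq : pd T i f y = a

namespace HasPd

variable {a b : ℝ}

theorem of_contDiffOn {n : WithTop ℕ∞} (hT : UniqueDiffOn ℝ T) (hf : ContDiffOn ℝ n f T)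
    (hn : n ≠ 0) (hy : y ∈ T) (i : Fin 2) : HasPd T i f (pd T i f y) y :=
  ⟨hf.differentiableOn hn y hy, hT y hy, rfl⟩

theorem add (hf : HasPd T i f a y) (hf' : HasPd T i f' b y) :
    HasPd T i (fun z => f z + f' z) (a + b) y :=
  ⟨hf.1.fun_add hf'.1, hf.2, by rw [pd_add hf.2 hf.1 hf'.1, hf.3, hf'.3]⟩

theorem sub (hf : HasPd T i f a y) (hf' : HasPd T i f' b y) :
    HasPd T i (fun z => f z - f' z) (a - b) y :=
  ⟨hf.1.fun_sub hf'.1, hf.2, by rw [pd_sub hf.2 hf.1 hf'.1, hf.3, hf'.3]⟩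

theorem mul (hf : HasPd T i f a y) (hf' : HasPd T i f' b y) :
    HasPd T i (fun z => f z * f' z) (a * f' y + f y * b) y :=
  ⟨hf.1.fun_mul hf'.1, hf.2, by rw [pd_mul hf.2 hf.1 hf'.1, hf.3, hf'.3]⟩

theorem const_mul (c : ℝ) (hf : HasPd T i f a y) : HasPd T i (fun z => c * f z) (c * a) y :=
  ⟨hf.1.const_mul c, hf.2, by rw [pd_const_mul hf.2 c hf.1, hf.3]⟩

theorem exp (hf : HasPd T i f a y) :
    HasPd T i (fun z => Real.exp (f z)) (Real.exp (f y) * a) y :=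
  ⟨hf.1.exp, hf.2, by rw [pd_exp hf.2 hf.1, hf.3]⟩

theorem inv (hf : HasPd T i f a y) (h : f y ≠ 0) :
    HasPd T i (fun z => (f z)⁻¹) (-a / f y ^ 2) y := by
  have hd := hf.1.fun_inv h
  refine ⟨hd, hf.2, ?_⟩
  have key : HasPd T i f (-f y ^ 2 * pd T i (fun z => (f z)⁻¹) y) y := by
    have h1 := (hf.mul (f' := fun z => (f z)⁻¹) ⟨hd, hf.2, rfl⟩).mul hf
    refine ⟨hf.1, hf.2, ?_⟩
    -- The identity `f · f⁻¹ · f = f` holds even where `f` vanishes, so differentiating it needs no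
    -- neighbourhood on which `f ≠ 0`.
    have h2 : pd T i (fun z => f z * (f z)⁻¹ * f z) y = pd T i f y :=
      congrArg (pd T i · y) (funext fun z => mul_inv_mul_cancel (f z))
    have h3 := h1.3
    rw [h2, hf.3] at h3
    rw [hf.3]
    have : f y * (f y)⁻¹ = 1 := mul_inv_cancel₀ h
    linear_combination -h3 - 2 * a * this
  rw [hf.3.symm.trans key.3]
  field_simp

theorem congr (hf : HasPd T i f a y) (h : EqOn f' f T) (hy : y ∈ T) : HasPd T i f' a y :=
  ⟨hf.1.congr h (h hy), hf.2, by rw [pd_congr h hy, hf.3]⟩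

end HasPd

/-! ### Curvature of a metric conformal to a flat one. -/

/-- A metric for which the coframe `u, w` of closed forms is orthogonal with both forms of
length `exp ℓ` has curvature `Δ ℓ`. -/
theorem IsMetricOn.gaussCurvature_eq_laplacian (h : IsMetricOn 2 T γ)
    {u w : Fin 2 → Plane → ℝ} {ℓ : Plane → ℝ} (hu : ∀ i, ContDiffOn ℝ 2 (u i) T)
    (hw : ∀ i, ContDiffOn ℝ 2 (w i) T) (hℓ : ContDiffOn ℝ 2 ℓ T)
    (hu_closed : ∀ z ∈ T, pd T 1 (u 0) z = pd T 0 (u 1) z)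
    (hw_closed : ∀ z ∈ T, pd T 1 (w 0) z = pd T 0 (w 1) z)
    (hd : ∀ z ∈ T, 0 < u 0 z * w 1 z - u 1 z * w 0 z)
    (hγ : ∀ z ∈ T, ∀ i j, γ z i j = Real.exp (-2 * ℓ z) * (u i z * u j z + w i z * w j z))
    (hy : y ∈ T) : gaussCurvature T γ y = laplacian T γ ℓ y := by
  have hT := h.uniqueDiffOn
  have two : (2 : WithTop ℕ∞) ≠ 0 := by norm_num
  have pu : ∀ z ∈ T, ∀ a b, HasPd T a (u b) (pd T a (u b) z) z :=
    fun z hz a b => .of_contDiffOn hT (hu b) two hz a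
  have pw : ∀ z ∈ T, ∀ a b, HasPd T a (w b) (pd T a (w b) z) z :=
    fun z hz a b => .of_contDiffOn hT (hw b) two hz a
  have pl : ∀ z ∈ T, ∀ a, HasPd T a ℓ (pd T a ℓ z) z :=
    fun z hz a => .of_contDiffOn hT hℓ two hz a
  have ppu : ∀ a b c, HasPd T a (pd T b (u c)) (pd T a (pd T b (u c)) y) y := fun a b c =>
    .of_contDiffOn hT (contDiffOn_pd (m := 1) hT (hu c) (by norm_num)) one_ne_zero hy a
  have ppw : ∀ a b c, HasPd T a (pd T b (w c)) (pd T a (pd T b (w c)) y) y := fun a b c =>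
    .of_contDiffOn hT (contDiffOn_pd (m := 1) hT (hw c) (by norm_num)) one_ne_zero hy a
  have ppl : ∀ a b, HasPd T a (pd T b ℓ) (pd T a (pd T b ℓ) y) y := fun a b =>
    .of_contDiffOn hT (contDiffOn_pd (m := 1) hT hℓ (by norm_num)) one_ne_zero hy a
  have pm : ∀ z ∈ T, ∀ a, HasPd T a (fun z => Real.exp (-2 * ℓ z))
      (Real.exp (-2 * ℓ z) * (-2 * pd T a ℓ z)) z := fun z hz a => ((pl z hz a).const_mul _).exp
  have ph : ∀ z ∈ T, ∀ a b c, HasPd T a (fun z => u b z * u c z + w b z * w c z)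
      ((pd T a (u b) z * u c z + u b z * pd T a (u c) z) +
        (pd T a (w b) z * w c z + w b z * pd T a (w c) z)) z := fun z hz a b c =>
    ((pu z hz a b).mul (pu z hz a c)).add ((pw z hz a b).mul (pw z hz a c))
  -- The value `_` is found by unification: the `HasPd` term mirrors the expression and carries its
  -- derivative.
  have pγ : ∀ z ∈ T, ∀ a b c, pd T a (fun z => γ z b c) z = _ := fun z hz a b c =>
    (((pm z hz a).mul (ph z hz a b c)).congr (fun z hz => hγ z hz b c) hz).pd_eq
  -- Closedness makes `∂_i u_j` and `∂_i w_j` symmetric, so the flat part contributes just `u_l ∂_i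
  -- u_j + w_l ∂_i w_j`; the terms in `∂ℓ` come from the conformal factor.
  have fk : ∀ z ∈ T, ∀ l i j, christoffelFirst T γ l i j z = Real.exp (-2 * ℓ z) *
      (u l z * pd T i (u j) z + w l z * pd T i (w j) z
        - pd T i ℓ z * (u j z * u l z + w j z * w l z)
        - pd T j ℓ z * (u i z * u l z + w i z * w l z)
        + pd T l ℓ z * (u i z * u j z + w i z * w j z)) := by
    intro z hz l i j
    have hu' : ∀ a b, pd T a (u b) z = pd T b (u a) z := by
      intro a b
      fin_cases a <;> fin_cases b <;> simp [hu_closed z hz]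
    have hw' : ∀ a b, pd T a (w b) z = pd T b (w a) z := by
      intro a b
      fin_cases a <;> fin_cases b <;> simp [hw_closed z hz]
    simp only [christoffelFirst, pγ z hz]
    rw [hu' j i, hw' j i, hu' l i, hu' l j, hw' l i, hw' l j]
    ring
  have pfk : ∀ a l i j, pd T a (christoffelFirst T γ l i j) y = _ := fun a l i j =>
    (((pm y hy a).mul ((((((pu y hy a l).mul (ppu a i j)).add ((pw y hy a l).mul (ppw a i j))).sub
      ((ppl a i).mul (ph y hy a j l))).sub ((ppl a j).mul (ph y hy a i l))).add
      ((ppl a l).mul (ph y hy a i j)))).congr (fun z hz => fk z hz l i j) hy).pd_eq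
  have hdet : ∀ z ∈ T, (γ z).det =
      (Real.exp (-2 * ℓ z) * (u 0 z * w 1 z - u 1 z * w 0 z)) ^ 2 := by
    intro z hz
    rw [Matrix.det_fin_two]
    simp only [hγ z hz]
    ring
  have hdens : ∀ z ∈ T, density γ z = Real.exp (-2 * ℓ z) * (u 0 z * w 1 z - u 1 z * w 0 z) := by
    intro z hz
    rw [density, hdet z hz, Real.sqrt_sq (mul_pos (Real.exp_pos _) (hd z hz)).le]
  -- The exponential drops out: in dimension two `√(det g) g^{ij}` is conformally invariant.
  have flux0 : EqOn (fun z => density γ z * grad T γ ℓ 0 z)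
      (fun z => ((u 1 z * u 1 z + w 1 z * w 1 z) * pd T 0 ℓ z -
        (u 0 z * u 1 z + w 0 z * w 1 z) * pd T 1 ℓ z) * (u 0 z * w 1 z - u 1 z * w 0 z)⁻¹) T := by
    intro z hz
    obtain ⟨i1, i2, -, -⟩ := inv_fin_two (γ z)
    simp only [grad, Fin.sum_univ_two, i1, i2, hdens z hz, hdet z hz, hγ z hz]
    have := (hd z hz).ne'
    have := (Real.exp_pos (-2 * ℓ z)).ne'
    field_simp
    ring
  have flux1 : EqOn (fun z => density γ z * grad T γ ℓ 1 z)
      (fun z => ((u 0 z * u 0 z + w 0 z * w 0 z) * pd T 1 ℓ z -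
        (u 0 z * u 1 z + w 0 z * w 1 z) * pd T 0 ℓ z) * (u 0 z * w 1 z - u 1 z * w 0 z)⁻¹) T := by
    intro z hz
    obtain ⟨-, -, i3, i4⟩ := inv_fin_two (γ z)
    simp only [grad, Fin.sum_univ_two, i3, i4, hdens z hz, hdet z hz, hγ z hz]
    have := (hd z hz).ne'
    have := (Real.exp_pos (-2 * ℓ z)).ne'
    field_simp
    ring
  have pd_inv_d := fun a => (((pu y hy a 0).mul (pw y hy a 1)).sub
    ((pu y hy a 1).mul (pw y hy a 0))).inv (hd y hy).ne'
  have pflux0 := ((((ph y hy 0 1 1).mul (ppl 0 0)).sub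
    ((ph y hy 0 0 1).mul (ppl 0 1))).mul (pd_inv_d 0)).congr flux0 hy |>.pd_eq
  have pflux1 := ((((ph y hy 1 0 0).mul (ppl 1 1)).sub
    ((ph y hy 1 0 1).mul (ppl 1 0))).mul (pd_inv_d 1)).congr flux1 hy |>.pd_eq
  have hK := h.gaussCurvature_eq hy
  rw [pfk, pfk] at hK
  refine mul_right_cancel₀ (h.det_pos y hy).ne' (hK.trans ?_)
  -- Commuting partial derivatives cancel the second derivatives of `u` and `w`. What remains is a
  -- rational identity with denominators built from `m = e^{-2ℓ}` and `d = u ∧ w`; `d` stays opaque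
  -- until they are cleared.
  obtain ⟨i1, i2, i3, i4⟩ := inv_fin_two (γ y)
  simp only [laplacian, div, Fin.sum_univ_two, pflux0, pflux1, christoffel_eq, i1, i2, i3, i4,
    hdens y hy, hdet y hy, hγ y hy, fk y hy, pd_comm (i := 1) (j := 0) hT h.subset_closure hℓ hy,
    ← pd_comm (i := 1) (j := 0) hT h.subset_closure (hu 1) hy,
    ← pd_comm (i := 1) (j := 0) hT h.subset_closure (hw 1) hy,
    hu_closed y hy, hw_closed y hy]
  have hd0 := (hd y hy).ne'
  have hm0 := (Real.exp_pos (-2 * ℓ y)).ne'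
  generalize Real.exp (-2 * ℓ y) = m at *
  generalize hD : u 0 y * w 1 y - u 1 y * w 0 y = d at *
  field_simp
  rw [← hD]
  ring

/-! ### Gradient fields in coordinates. -/

/-- The squared length of the gradient. -/
noncomputable def gradSq (s : Set Plane) (γ : Plane → Matrix (Fin 2) (Fin 2) ℝ) (f : Plane → ℝ)
    (y : Plane) : ℝ :=
  ∑ i, grad s γ f i y * pd s i f y

theorem IsMetricOn.contDiffOn_gradSq {n m k : WithTop ℕ∞} (h : IsMetricOn n T γ)
    (hf : ContDiffOn ℝ k f T) (hm : m + 1 ≤ k) (hmn : m ≤ n) :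
    ContDiffOn ℝ m (gradSq T γ f) T :=
  ContDiffOn.sum fun i _ => (h.contDiffOn_grad hf hm hmn i).mul
    (contDiffOn_pd h.uniqueDiffOn hf hm)

/-- The curvature-speed formula in coordinates: `K = Δ log |grad f|` for harmonic `f`. -/
theorem IsMetricOn.gaussCurvature_eq_laplacian_log (h : IsMetricOn 2 T γ)
    (hf : ContDiffOn ℝ 3 f T) (hΔ : ∀ z ∈ T, laplacian T γ f z = 0)
    (hpos : ∀ z ∈ T, 0 < gradSq T γ f z) (hy : y ∈ T) :
    gaussCurvature T γ y = laplacian T γ (fun z => Real.log (Real.sqrt (gradSq T γ f z))) y := by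
  have hT := h.uniqueDiffOn
  have hg := h.contDiffOn_grad (m := 2) hf (by norm_num) le_rfl
  have hD := h.contDiffOn_density
  have hDpos : ∀ z ∈ T, 0 < density γ z := fun z hz => Real.sqrt_pos.2 (h.det_pos z hz)
  have hDsq : ∀ z ∈ T, density γ z ^ 2 = γ z 0 0 * γ z 1 1 - γ z 0 1 * γ z 0 1 := by
    intro z hz
    rw [density, Real.sq_sqrt (h.det_pos z hz).le, Matrix.det_fin_two, ← h.symm z]
  have hsq : ContDiffOn ℝ 2 (gradSq T γ f) T :=
    h.contDiffOn_gradSq hf (by norm_num) le_rfl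
  have hlow : ∀ z ∈ T, ∀ l, γ z l 0 * grad T γ f 0 z + γ z l 1 * grad T γ f 1 z
      = pd T l f z := fun z hz l => by
    simpa only [Fin.sum_univ_two] using h.sum_mul_grad (f := f) hz l
  have hexp : ∀ z ∈ T,
      Real.exp (-2 * Real.log (Real.sqrt (gradSq T γ f z))) * gradSq T γ f z = 1 := by
    intro z hz
    rw [Real.log_sqrt (hpos z hz).le, show -2 * (Real.log (gradSq T γ f z) / 2) =
      -Real.log (gradSq T γ f z) by ring, Real.exp_neg, Real.exp_log (hpos z hz),
      inv_mul_cancel₀ (hpos z hz).ne']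
  -- Here `u = df`, and `w = *df` has components `-√(det g) X¹` and `√(det g) X⁰`, so that `dw` is
  -- the coordinate expression of `div X` times the area form.
  refine h.gaussCurvature_eq_laplacian (u := fun i => pd T i f)
    (w := ![fun z => -(density γ z * grad T γ f 1 z), fun z => density γ z * grad T γ f 0 z])
    (fun i => contDiffOn_pd hT hf (by norm_num)) ?_ ?_ ?_ ?_ ?_ ?_ hy
  · intro i
    fin_cases i
    · exact (hD.mul (hg 1)).neg
    · exact hD.mul (hg 0)
  · exact (hsq.sqrt fun z hz => (hpos z hz).ne').log fun z hz =>
      (Real.sqrt_pos.2 (hpos z hz)).ne'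
  · intro z hz
    exact pd_comm hT h.subset_closure (hf.of_le (by norm_num)) hz
  · intro z hz
    have := hΔ z hz
    simp only [laplacian, div, Fin.sum_univ_two, mul_eq_zero,
      inv_eq_zero, (hDpos z hz).ne', false_or] at this
    simp only [Matrix.cons_val_zero, Matrix.cons_val_one]
    rw [pd_neg (hT z hz)]
    linear_combination -this
  · intro z hz
    have := mul_pos (hDpos z hz) (hpos z hz)
    simp only [gradSq, Fin.sum_univ_two] at this
    simp only [Matrix.cons_val_zero, Matrix.cons_val_one]
    linarith
  · intro z hz
    -- The forms `df` and `*df` are an orthogonal coframe with both lengths `|X|`; after lowering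
    -- indices this is only `det g = g₀₀ g₁₁ - g₀₁²`.
    have key : ∀ i j, γ z i j * gradSq T γ f z = pd T i f z * pd T j f z +
        (![fun z => -(density γ z * grad T γ f 1 z), fun z => density γ z * grad T γ f 0 z] :
          Fin 2 → Plane → ℝ) i z *
        (![fun z => -(density γ z * grad T γ f 1 z), fun z => density γ z * grad T γ f 0 z] :
          Fin 2 → Plane → ℝ) j z := by
      have h0 := hlow z hz 0
      have h1 := hlow z hz 1
      have hs := h.symm z
      have hD2 := hDsq z hz
      intro i j
      simp only [gradSq, Fin.sum_univ_two, ← h0, ← h1]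
      fin_cases i <;> fin_cases j <;>
        simp only [Fin.zero_eta, Fin.mk_one, Matrix.cons_val_zero, Matrix.cons_val_one, ← h0, ← h1,
          ← hs]
      · linear_combination -(grad T γ f 1 z) ^ 2 * hD2
      · linear_combination (grad T γ f 0 z * grad T γ f 1 z) * hD2
      · linear_combination (grad T γ f 0 z * grad T γ f 1 z) * hD2
      · linear_combination -(grad T γ f 0 z) ^ 2 * hD2
    intro i j
    rw [← key i j]
    linear_combination -(γ z i j) * hexp z hz

/-- In coordinates, `∇_X X = grad (|X|² / 2)` for a gradient field `X`. -/
theorem IsMetricOn.nabla_grad (h : IsMetricOn 1 T γ) (hf : ContDiffOn ℝ 2 f T) (hy : y ∈ T)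
    (k : Fin 2) :
    nabla T γ (grad T γ f) (grad T γ f) k y = grad T γ (fun z => (1 / 2) * gradSq T γ f z) k y := by
  have hT := h.uniqueDiffOn
  have hsymm := fun a b => pd_comm (i := a) (j := b) hT h.subset_closure hf hy
  have pX : ∀ a b, HasPd T a (grad T γ f b) (pd T a (grad T γ f b) y) y := fun a b =>
    .of_contDiffOn hT (h.contDiffOn_grad (m := 1) hf (by norm_num) le_rfl b) one_ne_zero hy a
  have pu : ∀ a b, HasPd T a (pd T b f) (pd T a (pd T b f) y) y := fun a b =>
    .of_contDiffOn hT (contDiffOn_pd (m := 1) hT hf (by norm_num)) one_ne_zero hy a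
  have pγ : ∀ a b c, HasPd T a (fun z => γ z b c) (pd T a (fun z => γ z b c) y) y := fun a b c =>
    .of_contDiffOn hT (h.contDiffOn b c) one_ne_zero hy a
  have hlow : ∀ z ∈ T, ∀ l, pd T l f z =
      γ z l 0 * grad T γ f 0 z + γ z l 1 * grad T γ f 1 z := fun z hz l => by
    simpa only [Fin.sum_univ_two] using (h.sum_mul_grad (f := f) hz l).symm
  have dlow : ∀ a l, pd T a (pd T l f) y = _ := fun a l =>
    ((((pγ a l 0).mul (pX a 0)).add ((pγ a l 1).mul (pX a 1))).congr
      (fun z hz => hlow z hz l) hy).pd_eq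
  have dSq : ∀ a, pd T a (fun z => (1 / 2) * gradSq T γ f z) y = _ := fun a =>
    (((((pX a 0).mul (pu a 0)).add ((pX a 1).mul (pu a 1))).const_mul (1 / 2)).congr
      (fun z hz => by simp only [gradSq, Fin.sum_univ_two]) hy).pd_eq
  have hsym : (fun z => γ z 1 0) = fun z => γ z 0 1 := funext fun z => (h.symm z).symm
  -- With the index lowered the claim is `X^i ∇_i X_l = X^i ∇_l X_i = ∂_l (|X|²/2)`, the first
  -- equality being symmetry of the Hessian (`s01`).
  have lowered : ∀ l, ∑ k, γ y l k * nabla T γ (grad T γ f) (grad T γ f) k y =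
      pd T l (fun z => (1 / 2) * gradSq T γ f z) y := by
    intro l
    have e := fun i j => h.sum_mul_christoffel (i := i) (j := j) hy l
    have d00 := dlow 0 0
    have d01 := dlow 0 1
    have d10 := dlow 1 0
    have d11 := dlow 1 1
    have s01 := hsymm 0 1
    rw [dSq]
    simp only [Fin.sum_univ_two, christoffelFirst, nabla, hlow y hy] at e ⊢
    simp only [hsym, ← h.symm y] at d01 d11 e ⊢
    fin_cases l <;> simp only [Fin.zero_eta, Fin.mk_one, ← h.symm y] at e ⊢ <;>
      have e00 := e 0 0 <;> have e01 := e 0 1 <;> have e10 := e 1 0 <;> have e11 := e 1 1 <;>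
      simp only [hsym] at e01 e10 e11
    · linear_combination (grad T γ f 0 y) ^ 2 * e00 +
        grad T γ f 0 y * grad T γ f 1 y * (e01 + e10) + (grad T γ f 1 y) ^ 2 * e11
        - (grad T γ f 0 y * d00 + grad T γ f 1 y * d10)
        + (1 / 2) * (grad T γ f 0 y * d00 + grad T γ f 1 y * d01) - grad T γ f 1 y * s01
    · linear_combination (grad T γ f 0 y) ^ 2 * e00 +
        grad T γ f 0 y * grad T γ f 1 y * (e01 + e10) + (grad T γ f 1 y) ^ 2 * e11
        - (grad T γ f 0 y * d01 + grad T γ f 1 y * d11)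
        + (1 / 2) * (grad T γ f 0 y * d10 + grad T γ f 1 y * d11) + grad T γ f 0 y * s01
  have := sum_inv_mul_sum (h.det_pos y hy).ne'
    (fun k => nabla T γ (grad T γ f) (grad T γ f) k y) k
  rw [← this]
  simp only [lowered, grad]

theorem IsMetricOn.grad_const_mul {n : WithTop ℕ∞} (h : IsMetricOn n T γ) (c : ℝ)
    (hf : DifferentiableOn ℝ f T) (hy : y ∈ T) (k : Fin 2) :
    grad T γ (fun z => c * f z) k y = c * grad T γ f k y := by
  simp only [grad, pd_const_mul (h.uniqueDiffOn y hy) c (hf y hy), Finset.mul_sum]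
  exact Finset.sum_congr rfl fun _ _ => by ring

theorem IsMetricOn.laplacian_const_add_const_mul (h : IsMetricOn 1 T γ) (a c : ℝ)
    (hf : ContDiffOn ℝ 2 f T) (hy : y ∈ T) :
    laplacian T γ (fun z => a + c * f z) y = c * laplacian T γ f y := by
  have hT := h.uniqueDiffOn
  have hflux : ∀ i, ContDiffOn ℝ 1 (fun z => density γ z * grad T γ f i z) T := fun i =>
    h.contDiffOn_density.mul (h.contDiffOn_grad (m := 1) hf (by norm_num) le_rfl i)
  have : ∀ i, pd T i (fun z => density γ z * grad T γ (fun z => a + c * f z) i z) y =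
      c * pd T i (fun z => density γ z * grad T γ f i z) y := by
    intro i
    rw [← pd_const_mul (hT y hy) c ((hflux i).differentiableOn one_ne_zero y hy)]
    refine pd_congr (fun z hz => ?_) hy
    simp only [grad, pd_const_add]
    have := h.grad_const_mul c (hf.differentiableOn (by norm_num)) hz i
    simp only [grad] at this
    rw [this]
    ring
  simp only [laplacian, div, this, Finset.mul_sum]
  exact Finset.sum_congr rfl fun _ _ => by ring

theorem gradSq_inter {s O : Set Plane} (hO : IsOpen O) (hy : y ∈ s ∩ O) :
    gradSq s γ f y = gradSq (s ∩ O) γ f y := by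
  simp only [gradSq, grad_inter hO hy (eqOn_refl f _), pd_inter hO hy.2]

theorem fderivWithin_eq_zero_of_pd (h : ∀ i, pd T i f y = 0) : fderivWithin ℝ f T y = 0 := by
  refine ContinuousLinearMap.ext fun v => ?_
  have hv : v = ∑ i, v i • EuclideanSpace.single i (1 : ℝ) := by
    ext k
    fin_cases k <;> simp
  rw [hv, map_sum]
  simp only [map_smul]
  refine Finset.sum_eq_zero fun i _ => ?_
  have := h i
  rw [pd] at this
  rw [this, smul_zero]

theorem IsMetricOn.of_le {n m : WithTop ℕ∞} (h : IsMetricOn n T γ) (hm : m ≤ n) :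
    IsMetricOn m T γ :=
  { h with contDiffOn := fun i j => (h.contDiffOn i j).of_le hm }

end Coord

namespace Surface

variable {H : Type*} [TopologicalSpace H] {I : ModelWithCorners ℝ Plane H}
  {M : Type*} [TopologicalSpace M] {e : OpenPartialHomeomorph M H} {y : Plane}

/-! ### Coordinate vector fields -/

/-- Puts the chart image in the form `s ∩ O` to which the restriction lemmas apply. -/
theorem extend_target_eq (I : ModelWithCorners ℝ Plane H) (e : OpenPartialHomeomorph M H) :
    (e.extend I).target = range I ∩ I.symm ⁻¹' e.target := by
  rw [e.extend_target, inter_comm]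

theorem isOpen_symm_preimage (I : ModelWithCorners ℝ Plane H) (e : OpenPartialHomeomorph M H) :
    IsOpen (I.symm ⁻¹' e.target) :=
  e.open_target.preimage I.continuous_symm

theorem extend_target_mem_nhdsWithin (hy : y ∈ (e.extend I).target) :
    (e.extend I).target ∈ nhdsWithin y (range I) := by
  rw [extend_target_eq] at hy ⊢
  exact inter_mem_nhdsWithin _ ((isOpen_symm_preimage I e).mem_nhds hy.2)

theorem extend_symm_mem_source (hy : y ∈ (e.extend I).target) :
    (e.extend I).symm y ∈ e.source := by
  rw [← e.extend_source (I := I)]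
  exact (e.extend I).map_target hy

theorem uniqueMDiffWithinAt_range (hy : y ∈ (e.extend I).target) :
    UniqueMDiffWithinAt 𝓘(ℝ, Plane) (range I) y :=
  (I.uniqueDiffOn y (by rw [extend_target_eq] at hy; exact hy.1)).uniqueMDiffWithinAt

variable [ChartedSpace H M]

theorem contMDiffOn_extend_symm_target (he : e ∈ IsManifold.maximalAtlas I ∞ M) :
    ContMDiffOn 𝓘(ℝ, Plane) I ∞ (e.extend I).symm (e.extend I).target := by
  rw [e.extend_target']
  exact contMDiffOn_extend_symm he

theorem mdifferentiableAt_extend (he : e ∈ IsManifold.maximalAtlas I ∞ M)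
    (hy : y ∈ (e.extend I).target) :
    MDifferentiableAt I 𝓘(ℝ, Plane) (e.extend I) ((e.extend I).symm y) :=
  (e.contMDiffAt_extend he (extend_symm_mem_source hy)).mdifferentiableAt (by simp)

theorem mdifferentiableWithinAt_extend_symm (he : e ∈ IsManifold.maximalAtlas I ∞ M)
    (hy : y ∈ (e.extend I).target) :
    MDifferentiableWithinAt 𝓘(ℝ, Plane) I (e.extend I).symm (range I) y :=
  ((contMDiffOn_extend_symm_target he y hy).mdifferentiableWithinAt
    (by simp)).mono_of_mem_nhdsWithin (extend_target_mem_nhdsWithin hy)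

theorem mfderiv_coordVec (he : e ∈ IsManifold.maximalAtlas I ∞ M)
    (hy : y ∈ (e.extend I).target) {F : M → ℝ}
    (hF : MDifferentiableAt I 𝓘(ℝ, ℝ) F ((e.extend I).symm y)) (i : Fin 2) :
    mfderiv I 𝓘(ℝ, ℝ) F ((e.extend I).symm y) (coordVec I e i y) =
      Coord.pd (range I) i (F ∘ (e.extend I).symm) y := by
  have := mfderiv_comp_mfderivWithin y hF (mdifferentiableWithinAt_extend_symm he hy)
    (uniqueMDiffWithinAt_range hy)
  rw [Coord.pd, ← mfderivWithin_eq_fderivWithin, this]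
  rfl

theorem mfderiv_extend_coordVec (he : e ∈ IsManifold.maximalAtlas I ∞ M)
    (hy : y ∈ (e.extend I).target) (i : Fin 2) :
    mfderiv I 𝓘(ℝ, Plane) (e.extend I) ((e.extend I).symm y) (coordVec I e i y) =
      (EuclideanSpace.single i (1 : ℝ) : Plane) := by
  have h := mfderiv_comp_mfderivWithin y (mdifferentiableAt_extend he hy)
    (mdifferentiableWithinAt_extend_symm he hy) (uniqueMDiffWithinAt_range hy)
  have h2 : mfderivWithin 𝓘(ℝ, Plane) 𝓘(ℝ, Plane) (e.extend I ∘ (e.extend I).symm) (range I) y =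
      ContinuousLinearMap.id ℝ Plane := by
    have hid : (e.extend I ∘ (e.extend I).symm) =ᶠ[nhdsWithin y (range I)] id := by
      filter_upwards [extend_target_mem_nhdsWithin hy] with z hz
      exact (e.extend I).right_inv hz
    exact (hid.mfderivWithin_eq ((e.extend I).right_inv hy)).trans
      (mfderivWithin_id (I := 𝓘(ℝ, Plane)) (uniqueMDiffWithinAt_range hy))
  rw [h2] at h
  exact (congrArg (fun L : Plane →L[ℝ] Plane => L (EuclideanSpace.single i (1 : ℝ))) h).symm

theorem mfderivWithin_symm_mfderiv_extend (he : e ∈ IsManifold.maximalAtlas I ∞ M)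
    (hy : y ∈ (e.extend I).target) (v : TangentSpace I ((e.extend I).symm y)) :
    mfderivWithin 𝓘(ℝ, Plane) I (e.extend I).symm (range I) y
      (mfderiv I 𝓘(ℝ, Plane) (e.extend I) ((e.extend I).symm y) v : Plane) = v := by
  have hx := extend_symm_mem_source hy
  have hr := (e.extend I).right_inv hy
  have h := mfderivWithin_comp_of_eq (I := I) (I' := 𝓘(ℝ, Plane)) (I'' := I) (s := univ)
    (u := range I) (mdifferentiableWithinAt_extend_symm he hy)
    (mdifferentiableAt_extend he hy).mdifferentiableWithinAt
    (fun z _ => by simp) (uniqueMDiffWithinAt_univ I) hr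
  have h2 : mfderivWithin I I ((e.extend I).symm ∘ e.extend I) univ ((e.extend I).symm y) =
      ContinuousLinearMap.id ℝ _ := by
    have hid : ((e.extend I).symm ∘ e.extend I) =ᶠ[nhdsWithin ((e.extend I).symm y) univ] id := by
      filter_upwards [mem_nhdsWithin_of_mem_nhds (e.open_source.mem_nhds hx)] with z hz
      exact (e.extend I).left_inv (by rwa [e.extend_source])
    exact (hid.mfderivWithin_eq (congrArg (e.extend I).symm hr)).trans
      (mfderivWithin_id (I := I) (uniqueMDiffWithinAt_univ I))
  rw [h2, mfderivWithin_univ] at h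
  exact (congrArg (fun L : TangentSpace I ((e.extend I).symm y) →L[ℝ] Plane => L v) h).symm

theorem sum_components_smul_coordVec (he : e ∈ IsManifold.maximalAtlas I ∞ M)
    (hy : y ∈ (e.extend I).target) (X : (x : M) → TangentSpace I x) :
    ∑ i, components X e i y • coordVec I e i y = X ((e.extend I).symm y) := by
  let D : Plane →L[ℝ] TangentSpace I ((e.extend I).symm y) :=
    mfderivWithin 𝓘(ℝ, Plane) I (e.extend I).symm (range I) y
  have hD : D (∑ i, components X e i y • EuclideanSpace.single i (1 : ℝ)) =
      X ((e.extend I).symm y) := by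
    refine Eq.trans (congrArg D ?_)
      (mfderivWithin_symm_mfderiv_extend he hy (X ((e.extend I).symm y)))
    ext k
    fin_cases k <;> simp [components]
  rw [← hD, map_sum]
  simp only [map_smul]
  rfl

theorem coordVec_ne_zero (he : e ∈ IsManifold.maximalAtlas I ∞ M)
    (hy : y ∈ (e.extend I).target) (i : Fin 2) : coordVec I e i y ≠ 0 := by
  intro h
  let D : TangentSpace I ((e.extend I).symm y) →L[ℝ] Plane :=
    mfderiv I 𝓘(ℝ, Plane) (e.extend I) ((e.extend I).symm y)
  have hD : D (coordVec I e i y) = EuclideanSpace.single i (1 : ℝ) :=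
    mfderiv_extend_coordVec he hy i
  rw [h, map_zero] at hD
  simpa using congrArg (fun v : Plane => v i) hD

theorem eq_zero_of_smul_coordVec_sub_eq_zero (he : e ∈ IsManifold.maximalAtlas I ∞ M)
    (hy : y ∈ (e.extend I).target) {a b : ℝ} {i j : Fin 2} (hij : i ≠ j)
    (h : a • coordVec I e i y - b • coordVec I e j y = 0) : a = 0 := by
  let D : TangentSpace I ((e.extend I).symm y) →L[ℝ] Plane :=
    mfderiv I 𝓘(ℝ, Plane) (e.extend I) ((e.extend I).symm y)
  have hD : ∀ i, D (coordVec I e i y) = EuclideanSpace.single i (1 : ℝ) :=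
    mfderiv_extend_coordVec he hy
  have := congrArg D h
  rw [map_sub, map_smul, map_smul, hD, hD, map_zero] at this
  simpa [hij] using congrArg (fun v : Plane => v i) this

/-! ### The metric in coordinates -/

variable [IsManifold I ∞ M]

variable (g : ContMDiffRiemannianMetric I ∞ Plane (TangentSpace I : M → Type _))

/-- The field is the tangent map of the smooth inverse chart applied to a constant vector field of
the plane. -/
theorem contMDiffOn_coordVec (he : e ∈ IsManifold.maximalAtlas I ∞ M) (i : Fin 2) :
    ContMDiffOn 𝓘(ℝ, Plane) I.tangent ∞
      (fun z => (⟨(e.extend I).symm z, coordVec I e i z⟩ : TangentBundle I M))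
      (e.extend I).target := by
  have huniq : UniqueDiffOn ℝ (e.extend I).target := by
    rw [extend_target_eq]
    exact I.uniqueDiffOn.inter (isOpen_symm_preimage I e)
  have : IsManifold I 1 M := IsManifold.of_le (n := ∞) (by simp)
  have h := (contMDiffOn_extend_symm_target he).contMDiffOn_tangentMapWithin (m := ∞)
    (by simp) huniq.uniqueMDiffOn
  have hc : ContMDiff 𝓘(ℝ, Plane) 𝓘(ℝ, Plane).tangent ∞
      (fun z => (⟨z, EuclideanSpace.single i (1 : ℝ)⟩ : TangentBundle 𝓘(ℝ, Plane) Plane)) :=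
    contMDiff_vectorSpace_iff_contDiff.2 contDiff_const
  refine (h.comp hc.contMDiffOn fun z hz => hz).congr fun z hz => ?_
  have hsub : mfderivWithin 𝓘(ℝ, Plane) I (e.extend I).symm (e.extend I).target z =
      mfderivWithin 𝓘(ℝ, Plane) I (e.extend I).symm (range I) z :=
    mfderivWithin_subset (by rw [extend_target_eq]; exact inter_subset_left)
      (huniq z hz).uniqueMDiffWithinAt (mdifferentiableWithinAt_extend_symm he hz)
  simp only [Function.comp, tangentMapWithin, coordVec, hsub]

theorem contDiffOn_metricMatrix (he : e ∈ IsManifold.maximalAtlas I ∞ M) (i j : Fin 2) :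
    ContDiffOn ℝ ∞ (fun z => metricMatrix g e z i j) (e.extend I).target := by
  rw [← contMDiffOn_iff_contDiffOn]
  intro z hz
  have h := ContMDiffWithinAt.clm_bundle_apply₂ (F₁ := Plane) (F₂ := Plane) (F₃ := ℝ)
    (E₃ := Bundle.Trivial M ℝ)
    (g.contMDiff.contMDiffAt.comp_contMDiffWithinAt z (contMDiffOn_extend_symm_target he z hz))
    (contMDiffOn_coordVec he i z hz) (contMDiffOn_coordVec he j z hz)
  exact (Bundle.contMDiffWithinAt_totalSpace.1 h).2

theorem isMetricOn_metricMatrix (he : e ∈ IsManifold.maximalAtlas I ∞ M) :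
    Coord.IsMetricOn ∞ (range I ∩ I.symm ⁻¹' e.target) (metricMatrix g e) where
  uniqueDiffOn := I.uniqueDiffOn.inter (isOpen_symm_preimage I e)
  subset_closure := Coord.subset_closure_interior_inter (isOpen_symm_preimage I e)
    I.range_subset_closure_interior
  contDiffOn i j := by
    rw [← extend_target_eq]
    exact contDiffOn_metricMatrix g he i j
  symm z := g.symm _ _ _
  pos z hz := by
    rw [← extend_target_eq] at hz
    exact g.pos _ _ (coordVec_ne_zero he hz 0)
  det_pos z hz := by
    rw [← extend_target_eq] at hz
    have hE : 0 < metricMatrix g e z 0 0 := g.pos _ _ (coordVec_ne_zero he hz 0)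
    -- Gram–Schmidt without division: `W = g₀₀ ∂₁ - g₀₁ ∂₀` is nonzero and `g(W, W) = g₀₀ det g`.
    have hW := g.pos _ (metricMatrix g e z 0 0 • coordVec I e 1 z -
      metricMatrix g e z 0 1 • coordVec I e 0 z) fun h0 => hE.ne' <|
        eq_zero_of_smul_coordVec_sub_eq_zero he hz one_ne_zero h0
    have hsymm : metricMatrix g e z 1 0 = metricMatrix g e z 0 1 := g.symm _ _ _
    have hexp : g.inner _ (metricMatrix g e z 0 0 • coordVec I e 1 z -
        metricMatrix g e z 0 1 • coordVec I e 0 z) (metricMatrix g e z 0 0 • coordVec I e 1 z -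
        metricMatrix g e z 0 1 • coordVec I e 0 z) =
        metricMatrix g e z 0 0 * (metricMatrix g e z).det := by
      have hm : ∀ i j, g.inner _ (coordVec I e i z) (coordVec I e j z) =
        metricMatrix g e z i j := fun _ _ => rfl
      simp only [map_sub, map_smul, sub_apply, smul_apply, smul_eq_mul, hm,
        Matrix.det_fin_two, hsymm]
      ring
    rw [hexp] at hW
    exact pos_of_mul_pos_right hW hE.le

variable {g}

/-- Pairing `X` with `∂_j` gives `g_{jk} X^k = dφ(∂_j) = ∂_j φ`; the index is then raised. -/
theorem components_eq_grad (he : e ∈ IsManifold.maximalAtlas I ∞ M)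
    {X : (x : M) → TangentSpace I x} {φ : M → ℝ} (hX : IsVelocityPotential g X φ)
    (hy : y ∈ (e.extend I).target) (i : Fin 2) :
    components X e i y =
      Coord.grad (range I) (metricMatrix g e) (φ ∘ (e.extend I).symm) i y := by
  have hdet := (isMetricOn_metricMatrix g he).det_pos y (by rwa [← extend_target_eq])
  have hlow : ∀ j, ∑ k, metricMatrix g e y j k * components X e k y =
      Coord.pd (range I) j (φ ∘ (e.extend I).symm) y := by
    intro j
    rw [← mfderiv_coordVec he hy (hX.1 _), ← hX.2, ← sum_components_smul_coordVec he hy X]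
    simp only [Fin.sum_univ_two, map_add, map_smul, add_apply, smul_apply, smul_eq_mul]
    rw [g.symm _ (coordVec I e 0 y), g.symm _ (coordVec I e 1 y)]
    simp only [metricMatrix, Matrix.of_apply]
    ring
  rw [← Coord.sum_inv_mul_sum hdet.ne' (fun k => components X e k y) i]
  simp only [hlow, Coord.grad]

theorem inner_self_eq_gradSq (he : e ∈ IsManifold.maximalAtlas I ∞ M)
    {X : (x : M) → TangentSpace I x} {φ : M → ℝ} (hX : IsVelocityPotential g X φ)
    (hy : y ∈ (e.extend I).target) :
    g.inner _ (X ((e.extend I).symm y)) (X ((e.extend I).symm y)) =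
      Coord.gradSq (range I) (metricMatrix g e) (φ ∘ (e.extend I).symm) y := by
  rw [hX.2]
  conv_lhs => rw [← sum_components_smul_coordVec he hy X]
  simp only [map_sum, map_smul, mfderiv_coordVec he hy (hX.1 _), components_eq_grad he hX hy,
    Coord.gradSq]
  rfl

end Surface

/-! ### Harmonic potentials and the Euler equations -/

namespace Surface

variable {H : Type*} [TopologicalSpace H] {I : ModelWithCorners ℝ Plane H}
  {M : Type*} [TopologicalSpace M] {e : OpenPartialHomeomorph M H} {x : M} {y : Plane}

theorem extend_mem_target (hx : x ∈ e.source) :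
    e.extend I x ∈ range I ∩ I.symm ⁻¹' e.target := by
  rw [← extend_target_eq]
  exact (e.extend I).map_source (by rwa [e.extend_source])

theorem extend_symm_extend (hx : x ∈ e.source) : (e.extend I).symm (e.extend I x) = x :=
  (e.extend I).left_inv (by rwa [e.extend_source])

variable [ChartedSpace H M]

theorem contDiffOn_comp_extend_symm {n : WithTop ℕ∞} (hn : n ≤ ∞)
    (he : e ∈ IsManifold.maximalAtlas I ∞ M) {F : M → ℝ} (hF : ContMDiff I 𝓘(ℝ, ℝ) n F) :
    ContDiffOn ℝ n (F ∘ (e.extend I).symm) (range I ∩ I.symm ⁻¹' e.target) := by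
  rw [← extend_target_eq, ← contMDiffOn_iff_contDiffOn]
  exact hF.comp_contMDiffOn ((contMDiffOn_extend_symm_target he).of_le hn)

variable [IsManifold I ∞ M]

/-- A function on a connected surface whose partial derivatives vanish in all charts is
constant. -/
theorem exists_eq_const_of_pd_eq_zero [ConnectedSpace M] {F : M → ℝ}
    (hF : ContMDiff I 𝓘(ℝ, ℝ) 1 F)
    (h : ∀ e ∈ IsManifold.maximalAtlas I ∞ M, ∀ x ∈ e.source, ∀ i,
      Coord.pd (range I) i (F ∘ (e.extend I).symm) (e.extend I x) = 0) :
    ∃ c, ∀ q, F q = c := by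
  have hloc : IsLocallyConstant F := by
    rw [IsLocallyConstant.iff_eventually_eq]
    intro x
    set e := chartAt H x
    have he : e ∈ IsManifold.maximalAtlas I ∞ M := IsManifold.chart_mem_maximalAtlas x
    have hx : x ∈ e.source := mem_chart_source H x
    have hy := extend_mem_target (I := I) hx
    obtain ⟨r, hr, hball⟩ := Metric.isOpen_iff.1 (isOpen_symm_preimage I e) _ hy.2
    have hopen : IsOpen (Metric.ball (e.extend I x) r) := Metric.isOpen_ball
    have hsub : range I ∩ Metric.ball (e.extend I x) r ⊆ range I ∩ I.symm ⁻¹' e.target :=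
      inter_subset_inter_right _ hball
    have hdiff := ((contDiffOn_comp_extend_symm (by simp) he hF).mono hsub).differentiableOn
      one_ne_zero
    have hcont : ∀ᶠ q in nhds x, e.extend I q ∈ Metric.ball (e.extend I x) r :=
      (e.continuousAt_extend hx).eventually (Metric.ball_mem_nhds _ hr)
    filter_upwards [hcont, e.open_source.mem_nhds hx] with q hq hqs
    -- The range of the model is convex, so the mean value argument also works in half-balls at
    -- boundary points.
    have hconvex := I.convex_range.inter (convex_ball (e.extend I x) r)
    have hconst := hconvex.is_const_of_fderivWithin_eq_zero (𝕜 := ℝ) hdiff (fun z hz =>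
      Coord.fderivWithin_eq_zero_of_pd fun i => by
        have hz' : z ∈ (e.extend I).target := by
          rw [extend_target_eq]
          exact hsub hz
        have := h e he _ (extend_symm_mem_source hz') i
        rwa [(e.extend I).right_inv hz', ← Coord.pd_inter hopen hz.2] at this)
      ⟨(extend_mem_target hqs).1, hq⟩ ⟨hy.1, Metric.mem_ball_self hr⟩
    simpa only [Function.comp, extend_symm_extend hqs, extend_symm_extend hx] using hconst
  obtain ⟨x₀⟩ : Nonempty M := inferInstance
  exact ⟨F x₀, fun q => hloc.apply_eq_of_isPreconnected isPreconnected_univ trivial trivial⟩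

/-! ### The speed and the steady Euler equations. -/

variable {g : ContMDiffRiemannianMetric I ∞ Plane (TangentSpace I : M → Type _)}
  {X : (x : M) → TangentSpace I x} {φ : M → ℝ}

theorem speed_sq (x : M) : speed g X x ^ 2 = g.inner x (X x) (X x) := by
  refine Real.sq_sqrt ?_
  by_cases h : X x = 0
  · rw [h, map_zero]
  · exact (g.pos x _ h).le

theorem speed_sq_extend_symm (he : e ∈ IsManifold.maximalAtlas I ∞ M)
    (hX : IsVelocityPotential g X φ) (hy : y ∈ range I ∩ I.symm ⁻¹' e.target) :
    speed g X ((e.extend I).symm y) ^ 2 =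
      Coord.gradSq (range I) (metricMatrix g e) (φ ∘ (e.extend I).symm) y := by
  rw [speed_sq, inner_self_eq_gradSq he hX (by rwa [extend_target_eq])]

/-- The square is used because `|X|` itself may fail to be differentiable at zeros of `X`, whereas
`|X|² = X^i ∂_i φ` is as regular as `dφ`. -/
theorem contMDiff_speed_sq (hX : IsVelocityPotential g X φ) (hφ : ContMDiff I 𝓘(ℝ, ℝ) 2 φ) :
    ContMDiff I 𝓘(ℝ, ℝ) 1 (fun q => speed g X q ^ 2) := by
  intro x
  set e := chartAt H x
  have he : e ∈ IsManifold.maximalAtlas I ∞ M := IsManifold.chart_mem_maximalAtlas x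
  have hx : x ∈ e.source := mem_chart_source H x
  have hm := isMetricOn_metricMatrix g he
  have hc := (hm.contDiffOn_gradSq (m := 1) (contDiffOn_comp_extend_symm ENat.LEInfty.out he hφ)
    (by norm_num) (by simp)).contMDiffOn
  have := (hc.comp ((e.contMDiffOn_extend he).of_le (by simp)) fun q hq =>
    extend_mem_target hq).contMDiffAt (e.open_source.mem_nhds hx)
  refine this.congr_of_eventuallyEq ?_
  filter_upwards [e.open_source.mem_nhds hx] with q hq
  have hy := extend_mem_target (I := I) hq
  rw [Function.comp, ← Coord.gradSq_inter (isOpen_symm_preimage I e) hy,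
    ← speed_sq_extend_symm he hX hy, extend_symm_extend hq]

/-- In a chart, `∇_X X = grad (|X|² / 2)`. -/
theorem nabla_components (he : e ∈ IsManifold.maximalAtlas I ∞ M)
    (hX : IsVelocityPotential g X φ) (hφ : ContMDiff I 𝓘(ℝ, ℝ) 2 φ)
    (hy : y ∈ range I ∩ I.symm ⁻¹' e.target) (k : Fin 2) :
    Coord.nabla (range I) (metricMatrix g e) (components X e) (components X e) k y =
      Coord.grad (range I) (metricMatrix g e)
        ((fun q => (1 / 2) * speed g X q ^ 2) ∘ (e.extend I).symm) k y := by
  have hO := isOpen_symm_preimage I e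
  have hcomp : ∀ i, EqOn (components X e i) (Coord.grad (range I ∩ I.symm ⁻¹' e.target)
      (metricMatrix g e) (φ ∘ (e.extend I).symm) i) (range I ∩ I.symm ⁻¹' e.target) :=
    fun i z hz => by
      rw [components_eq_grad he hX (by rwa [extend_target_eq]),
        Coord.grad_inter hO hz (eqOn_refl _ _)]
  rw [Coord.nabla_inter hO hy hcomp, ((isMetricOn_metricMatrix g he).of_le (by simp)).nabla_grad
    (contDiffOn_comp_extend_symm ENat.LEInfty.out he hφ) hy]
  refine (Coord.grad_inter hO hy fun z hz => ?_).symm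
  simp only [Function.comp, speed_sq_extend_symm he hX hz, Coord.gradSq_inter hO hz]

theorem div_components (he : e ∈ IsManifold.maximalAtlas I ∞ M)
    (hX : IsVelocityPotential g X φ) (hφ : IsHarmonic g φ) (hx : x ∈ e.source) :
    Coord.div (range I) (metricMatrix g e) (components X e) (e.extend I x) = 0 := by
  have hO := isOpen_symm_preimage I e
  have hy := extend_mem_target (I := I) hx
  rw [← hφ.2 e he x hx, laplacianIn, Coord.laplacian_inter hO hy (eqOn_refl _ _), Coord.laplacian]
  refine Coord.div_inter hO hy fun i z hz => ?_
  rw [components_eq_grad he hX (by rwa [extend_target_eq]),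
    Coord.grad_inter hO hz (eqOn_refl _ _)]

theorem grad_const_mul_speed_sq (he : e ∈ IsManifold.maximalAtlas I ∞ M)
    (hX : IsVelocityPotential g X φ) (hφ : ContMDiff I 𝓘(ℝ, ℝ) 2 φ) (c : ℝ)
    (hy : y ∈ range I ∩ I.symm ⁻¹' e.target) (k : Fin 2) :
    Coord.grad (range I) (metricMatrix g e)
        ((fun q => c * speed g X q ^ 2) ∘ (e.extend I).symm) k y =
      c * Coord.grad (range I) (metricMatrix g e)
        ((fun q => speed g X q ^ 2) ∘ (e.extend I).symm) k y := by
  have hO := isOpen_symm_preimage I e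
  have hd := (contDiffOn_comp_extend_symm (by simp) he (contMDiff_speed_sq hX hφ)).differentiableOn
    one_ne_zero
  rw [Coord.grad_inter hO hy (eqOn_refl _ _), Coord.grad_inter hO hy (eqOn_refl _ _)]
  exact (isMetricOn_metricMatrix g he).grad_const_mul c hd hy k

theorem isSteadyEulerSolution_bernoulli (hX : IsVelocityPotential g X φ) (hφ : IsHarmonic g φ)
    {ρ₀ : ℝ} (hρ₀ : ρ₀ ≠ 0) :
    IsSteadyEulerSolution g ρ₀ X (fun q => -(ρ₀ / 2) * speed g X q ^ 2) := by
  refine ⟨contMDiff_const.mul (contMDiff_speed_sq hX hφ.1), fun e he x hx =>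
    ⟨fun k => ?_, div_components he hX hφ hx⟩⟩
  have hy := extend_mem_target (I := I) hx
  rw [nabla_components he hX hφ.1 hy, grad_const_mul_speed_sq he hX hφ.1 _ hy,
    grad_const_mul_speed_sq he hX hφ.1 _ hy]
  field_simp

/-- Bernoulli's law. -/
theorem IsSteadyEulerSolution.exists_bernoulli [ConnectedSpace M]
    (hX : IsVelocityPotential g X φ) (hφ : IsHarmonic g φ) {ρ₀ : ℝ} (hρ₀ : ρ₀ ≠ 0)
    {p : M → ℝ} (hp : IsSteadyEulerSolution g ρ₀ X p) :
    ∃ p₀ : ℝ, ∀ q, p q - p₀ = -(ρ₀ / 2) * speed g X q ^ 2 := by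
  have hS := contMDiff_speed_sq hX hφ.1
  obtain ⟨c, hc⟩ := exists_eq_const_of_pd_eq_zero (I := I)
    (F := fun q => p q + ρ₀ / 2 * speed g X q ^ 2) (hp.1.add (contMDiff_const.mul hS)) (by
      intro e he x hx i
      have hy := extend_mem_target (I := I) hx
      have hO := isOpen_symm_preimage I e
      have hm := isMetricOn_metricMatrix g he
      have hdp := (contDiffOn_comp_extend_symm (by simp) he hp.1).differentiableOn one_ne_zero _ hy
      have hdS := (contDiffOn_comp_extend_symm (by simp) he hS).differentiableOn one_ne_zero _ hy
      have hu := hm.uniqueDiffOn _ hy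
      have hgrad : ∀ k, Coord.grad (range I) (metricMatrix g e) (p ∘ (e.extend I).symm) k
          (e.extend I x) = -(ρ₀ / 2) * Coord.grad (range I) (metricMatrix g e)
            ((fun q => speed g X q ^ 2) ∘ (e.extend I).symm) k (e.extend I x) := by
        intro k
        have := ((hp.2 e he x hx).1 k).symm.trans (nabla_components he hX hφ.1 hy k)
        rw [grad_const_mul_speed_sq he hX hφ.1 _ hy] at this
        field_simp at this ⊢
        linarith
      -- Lowering the index turns the equality of gradients into one of partial derivatives.
      have hpd : Coord.pd (range I) i (p ∘ (e.extend I).symm) (e.extend I x) =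
          -(ρ₀ / 2) * Coord.pd (range I) i ((fun q => speed g X q ^ 2) ∘ (e.extend I).symm)
            (e.extend I x) := by
        rw [← Coord.pd_inter (f := p ∘ _) hO hy.2,
          ← Coord.pd_inter (f := (fun q => speed g X q ^ 2) ∘ _) hO hy.2, ← hm.sum_mul_grad hy,
          ← hm.sum_mul_grad hy, Finset.mul_sum]
        refine Finset.sum_congr rfl fun k _ => ?_
        rw [← Coord.grad_inter hO hy (eqOn_refl _ _), hgrad k,
          ← Coord.grad_inter hO hy (eqOn_refl _ _)]
        ring
      rw [← Coord.pd_inter (f := p ∘ _) hO hy.2,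
        ← Coord.pd_inter (f := (fun q => speed g X q ^ 2) ∘ _) hO hy.2] at hpd
      rw [← Coord.pd_inter hO hy.2]
      refine (Coord.pd_add hu hdp (hdS.const_mul (ρ₀ / 2))).trans ?_
      rw [Coord.pd_const_mul hu _ hdS, hpd]
      ring)
  refine ⟨c, fun q => ?_⟩
  have := hc q
  linarith

/-! ### Curvature formulas at regular points. -/

/-- Near a regular point where the potential is `C³` there is a coordinate domain on which it
is `C³` and has no critical points. -/
theorem exists_regular_domain (he : e ∈ IsManifold.maximalAtlas I ∞ M) (hx : x ∈ e.source)
    (hX : IsVelocityPotential g X φ) (hne : X x ≠ 0) (h3 : ContMDiffAt I 𝓘(ℝ, ℝ) 3 φ x) :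
    ∃ O : Set Plane, IsOpen O ∧ e.extend I x ∈ range I ∩ O ∧
      range I ∩ O ⊆ range I ∩ I.symm ⁻¹' e.target ∧
      Coord.IsMetricOn 2 (range I ∩ O) (metricMatrix g e) ∧
      ContDiffOn ℝ 3 (φ ∘ (e.extend I).symm) (range I ∩ O) ∧
      ∀ z ∈ range I ∩ O,
        0 < Coord.gradSq (range I) (metricMatrix g e) (φ ∘ (e.extend I).symm) z := by
  have hy := extend_mem_target (I := I) hx
  have hO := isOpen_symm_preimage I e
  have hm : Coord.IsMetricOn 2 (range I ∩ I.symm ⁻¹' e.target) (metricMatrix g e) :=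
    (isMetricOn_metricMatrix g he).of_le ENat.LEInfty.out
  have hf : ContDiffWithinAt ℝ 3 (φ ∘ (e.extend I).symm) (range I ∩ I.symm ⁻¹' e.target)
      (e.extend I x) := by
    rw [← contMDiffWithinAt_iff_contDiffWithinAt]
    rw [← extend_symm_extend (I := I) hx] at h3
    have := contMDiffOn_extend_symm_target (I := I) he
    rw [extend_target_eq] at this
    exact h3.comp_contMDiffWithinAt _ ((this _ hy).of_le ENat.LEInfty.out)
  -- Finite-order regularity at a point spreads to a neighbourhood; a further shrinking to `O₂`
  -- keeps the continuous function `|X|²` positive.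
  obtain ⟨u, hu, -, hfu⟩ := hf.contDiffOn (m := 3) le_rfl (by simp)
  rw [insert_eq_of_mem hy, mem_nhdsWithin] at hu
  obtain ⟨O₁, hO₁, hyO₁, hsub⟩ := hu
  have hm₁ := (hm.inter hO₁)
  have hf₁ : ContDiffOn ℝ 3 (φ ∘ (e.extend I).symm) (range I ∩ I.symm ⁻¹' e.target ∩ O₁) :=
    hfu.mono (by rwa [inter_comm])
  have hc := (hm₁.contDiffOn_gradSq (m := 1) hf₁ (by norm_num) (by norm_num)).continuousOn
  rw [inter_assoc] at hc hf₁ hm₁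
  have hpos : 0 < Coord.gradSq (range I ∩ (I.symm ⁻¹' e.target ∩ O₁)) (metricMatrix g e)
      (φ ∘ (e.extend I).symm) (e.extend I x) := by
    rw [← Coord.gradSq_inter (hO.inter hO₁) ⟨hy.1, hy.2, hyO₁⟩,
      ← inner_self_eq_gradSq he hX (by rwa [extend_target_eq]), extend_symm_extend hx]
    exact g.pos x _ hne
  obtain ⟨O₂, hO₂, hyO₂, hsub₂⟩ := mem_nhdsWithin.1
    ((hc _ ⟨hy.1, hy.2, hyO₁⟩).eventually (lt_mem_nhds hpos))
  refine ⟨I.symm ⁻¹' e.target ∩ O₁ ∩ O₂, (hO.inter hO₁).inter hO₂,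
    ⟨hy.1, ⟨hy.2, hyO₁⟩, hyO₂⟩, fun z hz => ⟨hz.1, hz.2.1.1⟩, ?_, ?_, fun z hz => ?_⟩
  · rw [← inter_assoc]
    exact hm₁.inter hO₂
  · exact hf₁.mono fun z hz => ⟨hz.1, hz.2.1⟩
  · rw [Coord.gradSq_inter (hO.inter hO₁) ⟨hz.1, hz.2.1⟩]
    exact hsub₂ ⟨hz.2.2, hz.1, hz.2.1⟩

theorem laplacian_extend_symm (he : e ∈ IsManifold.maximalAtlas I ∞ M) (hφ : IsHarmonic g φ)
    (hy : y ∈ range I ∩ I.symm ⁻¹' e.target) :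
    Coord.laplacian (range I) (metricMatrix g e) (φ ∘ (e.extend I).symm) y = 0 := by
  rw [← extend_target_eq] at hy
  have := hφ.2 e he _ (extend_symm_mem_source hy)
  rwa [laplacianIn, (e.extend I).right_inv hy] at this

/-- `Δ (a + c log |X|) = c K` at regular points of a harmonic velocity potential. -/
theorem laplacianIn_const_add_const_mul_log_speed (he : e ∈ IsManifold.maximalAtlas I ∞ M)
    (hx : x ∈ e.source) (hX : IsVelocityPotential g X φ) (hφ : IsHarmonic g φ) (hne : X x ≠ 0)
    (h3 : ContMDiffAt I 𝓘(ℝ, ℝ) 3 φ x) {a c : ℝ} {F : M → ℝ}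
    (hF : ∀ q, X q ≠ 0 → F q = a + c * Real.log (speed g X q)) :
    laplacianIn g e F x = c * gaussCurvatureIn g e x := by
  obtain ⟨O, hO, hy, hsub, hm, hf, hpos⟩ := exists_regular_domain he hx hX hne h3
  have hpos' : ∀ z ∈ range I ∩ O, 0 < Coord.gradSq (range I ∩ O) (metricMatrix g e)
      (φ ∘ (e.extend I).symm) z := fun z hz => by
    rw [← Coord.gradSq_inter hO hz]
    exact hpos z hz
  have hsq := hm.contDiffOn_gradSq (m := 2) hf (by norm_num) le_rfl
  have hlog : ContDiffOn ℝ 2 (fun z => Real.log (Real.sqrt (Coord.gradSq (range I ∩ O)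
      (metricMatrix g e) (φ ∘ (e.extend I).symm) z))) (range I ∩ O) :=
    (hsq.sqrt fun z hz => (hpos' z hz).ne').log fun z hz => (Real.sqrt_pos.2 (hpos' z hz)).ne'
  rw [laplacianIn, Coord.laplacian_inter hO hy (f' := fun z => a + c * Real.log (Real.sqrt
    (Coord.gradSq (range I ∩ O) (metricMatrix g e) (φ ∘ (e.extend I).symm) z))),
    (hm.of_le (by norm_num)).laplacian_const_add_const_mul a c hlog hy,
    ← hm.gaussCurvature_eq_laplacian_log hf (fun z hz => ?_) hpos' hy, gaussCurvatureIn,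
    Coord.gaussCurvature_inter hO hy]
  · rw [← Coord.laplacian_inter hO hz (eqOn_refl _ _)]
    exact laplacian_extend_symm he hφ (hsub hz)
  -- The formula for `F` is assumed only off the zeros of `X`, which is enough because `|X|² > 0` on
  -- `O`.
  · intro z hz
    have hz' : z ∈ (e.extend I).target := by
      rw [extend_target_eq]
      exact hsub hz
    have hinner := inner_self_eq_gradSq he hX hz'
    have hXz : X ((e.extend I).symm z) ≠ 0 := fun h0 => by
      rw [h0, map_zero] at hinner
      exact (hpos z hz).ne hinner
    simp only [Function.comp, hF _ hXz, speed, hinner, Coord.gradSq_inter hO hz]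

theorem log_const_mul_speed_sq {c : ℝ} (hc : 0 < c) (hne : X x ≠ 0) :
    Real.log (c * speed g X x ^ 2) = Real.log c + 2 * Real.log (speed g X x) := by
  have : speed g X x ≠ 0 := (Real.sqrt_pos.2 (g.pos x _ hne)).ne'
  rw [Real.log_mul hc.ne' (pow_ne_zero 2 this), Real.log_pow]
  norm_num

end Surface

theorem mainTheorem4 {H : Type*} [TopologicalSpace H] {I : ModelWithCorners ℝ Plane H}
    {M : Type*} [TopologicalSpace M] [ConnectedSpace M] [ChartedSpace H M] [IsManifold I ∞ M]
    (g : ContMDiffRiemannianMetric I ∞ Plane (TangentSpace I : M → Type _))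
    (X : (x : M) → TangentSpace I x) (φ : M → ℝ)
    (hX : Surface.IsVelocityPotential g X φ) (hφ : Surface.IsHarmonic g φ)
    (ρ₀ : ℝ) (hρ₀ : 0 < ρ₀) :
    -- the curvature-speed formula
    (∀ e ∈ IsManifold.maximalAtlas I ∞ M, ∀ x ∈ e.source,
      X x ≠ 0 → ContMDiffAt I 𝓘(ℝ, ℝ) 3 φ x →
        -Surface.laplacianIn g e (fun q => Real.log (Surface.speed g X q)) x
          = -Surface.gaussCurvatureIn g e x) ∧
    -- the field is a steady solution of the Euler equations
    (∃ p : M → ℝ, Surface.IsSteadyEulerSolution g ρ₀ X p) ∧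
    -- every pressure satisfies Bernoulli's law and the curvature-pressure formula
    (∀ p : M → ℝ, Surface.IsSteadyEulerSolution g ρ₀ X p →
      ∃ p₀ : ℝ, (∀ q, p q - p₀ = -(ρ₀ / 2) * Surface.speed g X q ^ 2) ∧
        ∀ e ∈ IsManifold.maximalAtlas I ∞ M, ∀ x ∈ e.source,
          X x ≠ 0 → ContMDiffAt I 𝓘(ℝ, ℝ) 3 φ x →
            -Surface.laplacianIn g e (fun q => Real.log (p₀ - p q)) x
              = -2 * Surface.gaussCurvatureIn g e x) := by
  refine ⟨fun e he x hx hne h3 => ?_, ⟨_, Surface.isSteadyEulerSolution_bernoulli hX hφ hρ₀.ne'⟩,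
    fun p hp => ?_⟩
  · rw [Surface.laplacianIn_const_add_const_mul_log_speed he hx hX hφ hne h3 (a := 0) (c := 1)
      fun q _ => by ring, one_mul]
  · obtain ⟨p₀, hp₀⟩ := hp.exists_bernoulli hX hφ hρ₀.ne'
    refine ⟨p₀, hp₀, fun e he x hx hne h3 => ?_⟩
    -- The constants come from `p₀ - p = (ρ₀/2)|X|²`: its logarithm is `log (ρ₀/2) + 2 log |X|`.
    rw [Surface.laplacianIn_const_add_const_mul_log_speed he hx hX hφ hne h3
      (a := Real.log (ρ₀ / 2)) (c := 2) fun q hq => ?_, neg_mul]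
    rw [← Surface.log_const_mul_speed_sq (half_pos hρ₀) hq]
    congr 1
    linarith [hp₀ q]
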